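/- **Setting.** Fix $U\in\mathbb N$ and let $\Delta^U=\{\mathbf q\in\mathbb R^{U+1}:\sum_{i=0}^U q_i=1,\ q_i\ge 0\}$ be the simplex of notification profiles, where $q_i$ is the fraction of riders that are notified to exactly $i$ drivers. Fix arrival rates $\lambda,\tilde\lambda>0$ of riders and drivers, a response rate $\mu>0$, an acceptance probability $p\in[0,1]$, a rider abandonment rate $\eta>0$, and departure rates $\tilde\eta_I>0$, $\tilde\eta_N\ge 0$ of idle and notified drivers, such that $c:=\mu(1-p)+\tilde\eta_N>0$. Put $\Pi_a^b=\prod_{j=a}^b\frac{jc}{\eta+j(\mu+\tilde\eta_N)}$ (empty products are $1$). **Fluid stage.** For $\mathbf q\in\Delta^U$ let $$R_0(\mathbf q)=\frac{\lambda}{\eta+\sum_{i=1}^U q_i(1-\Pi_1^i)} .$$ Under the first-accept protocol, let $$D_0(\mathbf q)=\frac1{\tilde\eta_I}\left(\tilde\lambda-(\mu p+\tilde\eta_N)\,\frac{\frac{\lambda}{c}\sum_{\ell=1}^U\sum_{i=\ell}^U q_i\Pi_\ell^i}{\eta+\sum_{i=1}^U q_i(1-\Pi_1^i)}\right).$$ Under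 the best-accept protocol, let $$D_0(\mathbf q)=\frac{1}{\tilde\eta_I}\left(\tilde\lambda+\sum_{\ell=1}^U D_\ell\bigl(\eta+\mu(1-p)+(\ell-1)\mu p\bigr)+\sum_{\ell=2}^U A_\ell\bigl(\eta+(\ell-1)\mu p\bigr)-R_0\sum_{\ell=1}^U\ell q_\ell\right),$$ where $$D_\ell=R_0\sum_{j=\ell}^U\frac{\Pi_\ell^j\sum_{i=j}^U q_i}{jc},\qquad A_\ell=R_0\left(\frac{\sum_{i=\ell-1}^U q_i(1-\Pi_\ell^i)}{\eta+(\ell-1)(\tilde\eta_N+\mu)}-\sum_{j=\ell}^U\frac{\eta+(\ell-1)\mu p}{\eta+(\ell-1)(\tilde\eta_N+\mu)}\cdot\frac{\Pi_\ell^j\sum_{i=j}^U q_i}{jc}\right).$$ **Simulation stage.** Fix one of the two protocols, a (possibly randomized, measurable) packing algorithm, and a number $K\ge 1$ of instances. The algorithm receives the matrix of scores of a market with $m$ riders and $n$ drivers, and returns pairwise disjoint sets of notified drivers, one for each rider, each with at most $U$ elements. Given real market sizes $(R_0,D_0)$, round each of them independently to a nonnegative integer: $x\ge0$ becomes $\lceil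 x\rceil$ with probability $x-\lfloor x\rfloor$ and $\lfloor x\rfloor$ otherwise, and $x<0$ becomes $0$. Let $(m,n)$ be the result. Sample $K$ independent instances with $m$ riders and $n$ drivers located in the plane, all coordinates being independent standard normal variables, where a rider-driver pair at Euclidean distance $d$ has score $1/(1+d)$, and run the algorithm on each. The empirical frequency vector has as its $i$-th entry ($0\le i\le U$) the fraction, among the $Km$ sampled riders, of those who are notified to exactly $i$ drivers; if $m=0$, it is a fixed profile $\mathbf q^{\varnothing}\in\Delta^U$, chosen arbitrarily in advance. Let $\mathbf q'$ be the expectation of the empirical frequency vector, over the rounding, the locations and the randomness of the algorithm. **Theorem.** The composite map $F:\mathbf q\mapsto(R_0(\mathbf q),D_0(\mathbf q))\mapsto\mathbf q'$ maps $\Delta^U$ into itself and has a fixed point: there is $\mathbf q^*\in\Delta^U$ with $F(\mathbf q^*)=\mathbf q^*$. Moreover, $\mathbf q^*$ can be chosen with $R_0(\mathbf q^*)>0$ and such that $D_0(\mathbf q^*)>0$ whenever $R_0(\mathbf q^*)\ge 1$ or $\mathbf q^{\varnothing}=(1,0,\dots,0)$. -/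

import Mathlib

open MeasureTheory ProbabilityTheory Finset

noncomputable section

namespace NED

/-! ### Fluid model -/

/-- Contention resolution: first-accept or best-accept. -/
inductive Protocol where
  | firstAccept
  | bestAccept

/-- The rates of the fluid model: `lam`, `lamD` are the arrival rates of riders and drivers, `mu` the
response rate of a notified driver, `p` the acceptance probability, `eta` the abandonment rate of
riders, `etaI` and `etaN` the departure rates of idle and of notified drivers. -/
structure Params where
  lam : ℝ
  lamD : ℝ
  mu : ℝ
  p : ℝ
  eta : ℝ
  etaI : ℝ
  etaN : ℝ

/-- Admissible rates. The last field says that a notified driver can leave the notified state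
without accepting; this is the quantity by which the closed forms divide. -/
structure Params.Admissible (P : Params) : Prop where
  lam_pos : 0 < P.lam
  lamD_pos : 0 < P.lamD
  mu_pos : 0 < P.mu
  p_nonneg : 0 ≤ P.p
  p_le_one : P.p ≤ 1
  eta_pos : 0 < P.eta
  etaI_pos : 0 < P.etaI
  etaN_nonneg : 0 ≤ P.etaN
  reject_pos : 0 < P.mu * (1 - P.p) + P.etaN

/-- Notification profiles `(q_0, …, q_U)`; the simplex is `stdSimplex ℝ (Fin (U + 1))`. -/
abbrev Profile (U : ℕ) := Fin (U + 1) → ℝ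

/-- The entry `q_i`, for a natural number `i` (zero if `i > U`). -/
def Profile.entry {U : ℕ} (q : Profile U) (i : ℕ) : ℝ :=
  if h : i < U + 1 then q ⟨i, h⟩ else 0

/-- The profile under which no rider is notified to any driver: `q_0 = 1`. -/
def Profile.idle (U : ℕ) : Profile U := Pi.single 0 1

namespace Params

variable (P : Params)

/-- `μ(1-p) + η_N`. -/
def c : ℝ := P.mu * (1 - P.p) + P.etaN

/-- `∏_{j=a}^{b} j (μ(1-p)+η_N) / (η + j (μ+η_N))`; the empty product is one. -/
def ratioProd (a b : ℕ) : ℝ :=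
  ∏ j ∈ Icc a b, ((j : ℝ) * P.c / (P.eta + (j : ℝ) * (P.mu + P.etaN)))

variable {U : ℕ} (q : Profile U)

/-- `η + ∑_{i=1}^U q_i (1 - ∏_{j=1}^i …)`. -/
def exitRate : ℝ :=
  P.eta + ∑ i ∈ Icc 1 U, q.entry i * (1 - P.ratioProd 1 i)

/-- The mass `R_0` of riders awaiting notification (the same formula under both protocols). -/
def R0 : ℝ := P.lam / P.exitRate q

/-- The mass `D_0` of idle drivers under first-accept. -/
def D0FA : ℝ :=
  (P.lamD - (P.mu * P.p + P.etaN) *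
    ((P.lam / P.c * ∑ l ∈ Icc 1 U, ∑ i ∈ Icc l U, q.entry i * P.ratioProd l i)
      / P.exitRate q)) / P.etaI

/-- The mass `A_l` of riders in the `l`-th accepted state under best-accept, `2 ≤ l ≤ U`; it is
also the mass of drivers in the `l`-th accepted state. -/
def ABA (l : ℕ) : ℝ :=
  P.R0 q *
    ((∑ i ∈ Icc (l - 1) U, q.entry i * (1 - P.ratioProd l i))
        / (P.eta + ((l : ℝ) - 1) * (P.etaN + P.mu))
      - ∑ j ∈ Icc l U,
          ((P.eta + ((l : ℝ) - 1) * P.mu * P.p) / (P.eta + ((l : ℝ) - 1) * (P.etaN + P.mu))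
              * P.ratioProd l j * ∑ i ∈ Icc j U, q.entry i)
            / ((j : ℝ) * P.c))

/-- The mass `D_l` of notified drivers of rank `l` under best-accept, `1 ≤ l ≤ U`. -/
def DBA (l : ℕ) : ℝ :=
  P.R0 q * ∑ j ∈ Icc l U,
    (P.ratioProd l j * ∑ i ∈ Icc j U, q.entry i) / ((j : ℝ) * P.c)

/-- The mass `D_0` of idle drivers under best-accept. -/
def D0BA : ℝ :=
  (P.lamD
    + ∑ l ∈ Icc 1 U,
        P.DBA q l * (P.eta + P.mu * (1 - P.p) + ((l : ℝ) - 1) * P.mu * P.p)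
    + ∑ l ∈ Icc 2 U, P.ABA q l * (P.eta + ((l : ℝ) - 1) * P.mu * P.p)
    - P.R0 q * ∑ l ∈ Icc 1 U, (l : ℝ) * q.entry l) / P.etaI

/-- The mass `D_0` of idle drivers. -/
def D0 (prot : Protocol) : ℝ :=
  match prot with
  | .firstAccept => P.D0FA q
  | .bestAccept => P.D0BA q

end Params

/-! ### Simulation environment -/

/-- Notification sets of a single cycle with `m` riders and `n` drivers: every rider is notified to
at most `U` drivers and no driver receives two notifications. -/
def Packing (U m n : ℕ) : Type :=
  {S : Fin m → Finset (Fin n) // Pairwise (fun r r' => Disjoint (S r) (S r')) ∧ ∀ r, #(S r) ≤ U}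

instance (U m n : ℕ) : MeasurableSpace (Packing U m n) := ⊤

/-- A (possibly randomized) packing algorithm: for each market size, it chooses notification sets
given the matrix of scores of the rider-driver pairs. -/
structure DispatchAlgorithm (U : ℕ) where
  toKernel : ∀ m n : ℕ, Kernel (Fin m → Fin n → ℝ) (Packing U m n)
  isMarkov : ∀ m n : ℕ, IsMarkovKernel (toKernel m n)

abbrev Plane := EuclideanSpace ℝ (Fin 2)

/-- Locations of `m` riders and `n` drivers, independent with standard normal coordinates. -/
def snapshotLaw (m n : ℕ) : Measure ((Fin m → Plane) × (Fin n → Plane)) :=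
  (Measure.pi fun _ => stdGaussian Plane).prod (Measure.pi fun _ => stdGaussian Plane)

/-- The score of a pair at Euclidean distance `d` is `1 / (1 + d)`. -/
def score {m n : ℕ} (x : (Fin m → Plane) × (Fin n → Plane)) (r : Fin m) (d : Fin n) : ℝ :=
  1 / (1 + dist (x.1 r) (x.2 d))

/-- The law of the notification sets in one sampled instance with `m` riders and `n` drivers. -/
def outcomeLaw {U : ℕ} (alg : DispatchAlgorithm U) (m n : ℕ) : Measure (Packing U m n) :=
  ((snapshotLaw m n).map score).bind (alg.toKernel m n)

/-- The number of riders that are notified to exactly `i` drivers. -/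
def Packing.count {U m n : ℕ} (S : Packing U m n) (i : Fin (U + 1)) : ℕ :=
  #{r : Fin m | #(S.1 r) = (i : ℕ)}

/-- The empirical frequency vector over `K` instances with `m` riders and `n` drivers each. If there
are no riders, the profile `qe` is reported. -/
def empiricalFreq {U m n K : ℕ} (qe : Profile U) (ω : Fin K → Packing U m n) : Profile U :=
  fun i => if m = 0 then qe i else (∑ k, ((ω k).count i : ℝ)) / ((K : ℝ) * (m : ℝ))

/-- The expected empirical frequency vector over `K` independent instances with `m` riders and `n`
drivers each. -/
def expectedFreq {U : ℕ} (alg : DispatchAlgorithm U) (K : ℕ) (qe : Profile U) (m n : ℕ) :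
    Profile U :=
  fun i => ∫ ω, empiricalFreq qe ω i ∂(Measure.pi fun _ : Fin K => outcomeLaw alg m n)

/-- Probabilistic rounding: `x` becomes `⌈x⌉` with probability `x - ⌊x⌋`, and `⌊x⌋` otherwise.
Negative values are replaced by zero (`⌈x⌉₊ = ⌊x⌋₊ = 0` for `x ≤ 0`). -/
def roundLaw (x : ℝ) : Measure ℕ :=
  ENNReal.ofReal (Int.fract x) • Measure.dirac ⌈x⌉₊
    + ENNReal.ofReal (1 - Int.fract x) • Measure.dirac ⌊x⌋₊

/-- The expected empirical profile produced by the simulator from real market sizes `x` (riders) and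
`y` (drivers), which are rounded independently. -/
def simulate {U : ℕ} (alg : DispatchAlgorithm U) (K : ℕ) (qe : Profile U) (x y : ℝ) : Profile U :=
  fun i => ∫ s : ℕ × ℕ, expectedFreq alg K qe s.1 s.2 i ∂((roundLaw x).prod (roundLaw y))

/-- One iteration of the procedure: from the assumed profile to the market sizes, and from these to
the expected empirical profile. -/
def iterMap {U : ℕ} (P : Params) (prot : Protocol) (alg : DispatchAlgorithm U) (K : ℕ)
    (qe : Profile U) (q : Profile U) : Profile U :=
  simulate alg K qe (P.R0 q) (P.D0 q prot)

end NED

end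

/-! The simulator may be arbitrarily discontinuous in its scores, but it is only run at integer
market sizes. Averaging over the rounding interpolates the values at these sizes by tent functions,
so the simulation stage is continuous in the real sizes (`continuous_integral_roundLaw_prod`). The
fluid stage is continuous because its only profile-dependent denominator, `exitRate`, is at least
`eta` on the simplex. An average of frequency vectors stays in the simplex, and Brouwer's theorem
gives a fixed point.

For positivity, suppose `D0 ≤ 0` at the fixed point. Then every sampled market has no drivers, so
under either alternative of the hypothesis the output is the idle profile. Hence the fixed point is
idle; but there `D0 = lamD / etaI > 0`.

Brouwer's theorem is proved analytically. For compactly supported C¹ `g` and small `t`, `x + t g(x)`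
maps a large ball bijectively onto itself, so the integral of `φ(x + t g(x)) det(1 + t g'(x))`
equals that of `φ`. The integrand is polynomial in `t` when `φ` is polynomial on lines, so this
persists at `t = 1`. If `x + g(x)` had no zero, taking `φ` to be high powers of a function peaked at
`0` would be contradictory. -/

namespace Brouwer

/-! ### Polynomials: determinants and extrapolation -/

open Polynomial in
/-- `t ↦ det (1 + t A)` is a polynomial function of degree at most the dimension. -/
theorem exists_polynomial_det_one_add_smul {E : Type*} [NormedAddCommGroup E] [NormedSpace ℝ E]
    [FiniteDimensional ℝ E] (A : E →L[ℝ] E) :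
    ∃ p : ℝ[X], p.natDegree ≤ Module.finrank ℝ E ∧
      ∀ t : ℝ, p.eval t = (ContinuousLinearMap.id ℝ E + t • A).det := by
  classical
  let b := Module.finBasis ℝ E
  let M := LinearMap.toMatrix b b (A : E →ₗ[ℝ] E)
  refine ⟨((X : ℝ[X]) • M.map C + (1 : Matrix _ _ ℝ).map C).det, ?_, fun t => ?_⟩
  · simpa using natDegree_det_X_add_C_le M 1
  · have h : (ContinuousLinearMap.id ℝ E + t • A).det =
        (LinearMap.toMatrix b b (ContinuousLinearMap.id ℝ E + t • A : E →L[ℝ] E)).det :=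
      (LinearMap.det_toMatrix b _).symm
    rw [h, ← coe_evalRingHom, RingHom.map_det]
    congr 1
    ext i j
    simp [M, LinearMap.toMatrix_apply, Matrix.one_apply, Finsupp.single_apply, add_comm, eq_comm,
      apply_ite (eval t), mul_comm t]

/-- A polynomial of degree at most `N` is determined at `1` by its values at `N + 1` nodes, through
weights that sum to one. -/
theorem exists_extrapolation_weights (N : ℕ) {ε : ℝ} (hε : 0 < ε) :
    ∃ (v w : Fin (N + 1) → ℝ), (∀ i, 0 < v i ∧ v i < ε) ∧ ∑ i, w i = 1 ∧
      ∀ p : Polynomial ℝ, p.natDegree ≤ N → p.eval 1 = ∑ i, w i * p.eval (v i) := by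
  -- Equally spaced nodes strictly inside `(0, ε)`.
  let v : Fin (N + 1) → ℝ := fun i => ε * ((i : ℝ) + 1) / (N + 2)
  have hN : (0 : ℝ) < N + 2 := by positivity
  have hv : Function.Injective v := by
    intro i j h
    simp only [v] at h
    field_simp at h
    exact Fin.ext (by exact_mod_cast (add_right_cancel h))
  have key : ∀ p : Polynomial ℝ, p.natDegree ≤ N →
      p.eval 1 = ∑ i, (Lagrange.basis univ v i).eval 1 * p.eval (v i) := by
    intro p hp
    conv_lhs => rw [Lagrange.eq_interpolate (s := univ) (v := v) (f := p) hv.injOn (by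
      refine lt_of_le_of_lt Polynomial.degree_le_natDegree ?_
      simp only [card_univ, Fintype.card_fin]
      exact_mod_cast Nat.lt_succ_of_le hp)]
    simp [Lagrange.interpolate_apply, Polynomial.eval_finsetSum, mul_comm]
  refine ⟨v, fun i => (Lagrange.basis univ v i).eval 1, fun i => ⟨by positivity, ?_⟩, ?_, key⟩
  · simp only [v]
    rw [div_lt_iff₀ hN]
    have : (i : ℝ) + 1 ≤ N + 1 := by exact_mod_cast i.2
    nlinarith
  -- The weights sum to one because the formula holds for the constant polynomial `1`.
  · simpa using (key 1 (by simp)).symm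

/-! ### Small Lipschitz perturbations of the identity -/

section Perturbation

variable {E : Type*} [NormedAddCommGroup E] [NormedSpace ℝ E] {g : E → E} {K : NNReal} {t : ℝ}

theorem id_add_smul_injective (hg : LipschitzWith K g) (ht : 0 ≤ t) (htK : t * K < 1) :
    Function.Injective fun x => x + t • g x := by
  intro x y h
  have h1 : x - y = t • (g y - g x) := by
    simp only at h
    rw [smul_sub, sub_eq_sub_iff_add_eq_add, h, add_comm]
  have h2 : ‖x - y‖ ≤ t * K * ‖x - y‖ := by
    calc ‖x - y‖ = t * ‖g y - g x‖ := by rw [h1, norm_smul, Real.norm_of_nonneg ht]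
      _ ≤ t * (K * ‖y - x‖) := by gcongr; exact hg.norm_sub_le _ _
      _ = _ := by rw [norm_sub_rev]; ring
  have : ‖x - y‖ = 0 := by nlinarith [norm_nonneg (x - y)]
  exact sub_eq_zero.1 (norm_eq_zero.1 this)

/-- A preimage of `y` is a fixed point of the contraction `x ↦ y - t • g x`. -/
theorem id_add_smul_surjective [CompleteSpace E] (hg : LipschitzWith K g) (ht : 0 ≤ t)
    (htK : t * K < 1) : Function.Surjective fun x => x + t • g x := by
  intro y
  have hc : ContractingWith (⟨t, ht⟩ * K) fun x => y - t • g x := by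
    refine ⟨by exact_mod_cast htK, LipschitzWith.of_dist_le_mul fun a b => ?_⟩
    rw [dist_sub_left, dist_smul₀, Real.norm_of_nonneg ht]
    calc t * dist (g a) (g b) ≤ t * (K * dist a b) :=
          mul_le_mul_of_nonneg_left (hg.dist_le_mul a b) ht
      _ = _ := by rw [← mul_assoc]; rfl
  refine ⟨hc.fixedPoint, ?_⟩
  have := hc.fixedPoint_isFixedPt
  have h2 : y - t • g hc.fixedPoint = hc.fixedPoint := this
  simp only
  nth_rewrite 1 [← h2]
  simp

/-- Points outside `s` are fixed, so by injectivity no point of `s` can land on one of them;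
surjectivity does the rest. -/
theorem id_add_smul_image_eq [CompleteSpace E] (hg : LipschitzWith K g) (ht : 0 ≤ t)
    (htK : t * K < 1) {s : Set E} (hs : ∀ x ∉ s, g x = 0) :
    (fun x => x + t • g x) '' s = s := by
  ext y
  constructor
  · rintro ⟨x, hx, rfl⟩
    by_contra hy
    have : x + t • g x = x := id_add_smul_injective hg ht htK (by simp [hs _ hy])
    exact hy (by simpa only [this] using hx)
  · intro hy
    obtain ⟨x, rfl⟩ := id_add_smul_surjective hg ht htK y
    by_cases hx : x ∈ s
    · exact ⟨x, hx, rfl⟩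
    · exact absurd (by simpa [hs x hx] using hy) hx

/-- A kernel vector of `1 + s A` would contradict `s ‖A‖ < 1`, so the determinant never vanishes on
`[0, t]`; it is `1` at `s = 0`, so it keeps its sign. This removes the absolute value in the change
of variables. -/
theorem det_id_add_smul_pos [FiniteDimensional ℝ E] (A : E →L[ℝ] E) (hA : ‖A‖ ≤ K) (ht : 0 ≤ t)
    (htK : t * K < 1) : 0 < (ContinuousLinearMap.id ℝ E + t • A).det := by
  have hne : ∀ s ∈ Set.Icc 0 t, (ContinuousLinearMap.id ℝ E + s • A).det ≠ 0 := by
    intro s hs h0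
    obtain ⟨v, hv, hv0⟩ := Submodule.exists_mem_ne_zero_of_ne_bot
      (LinearMap.bot_lt_ker_of_det_eq_zero h0).ne'
    have h1 : v = -(s • A v) := eq_neg_of_add_eq_zero_left (by simpa using hv)
    have h2 : ‖v‖ ≤ t * K * ‖v‖ := by
      calc ‖v‖ = s * ‖A v‖ := by
            conv_lhs => rw [h1, norm_neg, norm_smul, Real.norm_of_nonneg hs.1]
        _ ≤ t * (K * ‖v‖) := by
            gcongr
            · exact hs.2
            · exact A.le_of_opNorm_le hA v
        _ = _ := by ring
    have := norm_pos_iff.2 hv0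
    nlinarith
  obtain ⟨p, -, hp⟩ := exists_polynomial_det_one_add_smul A
  simp only [← hp] at hne ⊢
  by_contra! hle
  have h0 : p.eval 0 = 1 := by simp [hp, ContinuousLinearMap.det]
  obtain ⟨s, hs, hs0⟩ := intermediate_value_Icc' ht (f := fun s => p.eval s)
    p.continuous.continuousOn ⟨hle, by rw [h0]; exact zero_le_one⟩
  exact hne s hs hs0

end Perturbation

/-! ### Change of variables, zeros and Brouwer's theorem -/

open Metric

variable {E : Type*} [NormedAddCommGroup E] [InnerProductSpace ℝ E] [FiniteDimensional ℝ E]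

/-- The change of variables formula for a map that is the identity outside of a ball, without
injectivity, for test functions that are polynomial along lines. -/
theorem setIntegral_comp_id_add_mul_det [MeasurableSpace E] [BorelSpace E] (ν : Measure E)
    [ν.IsAddHaarMeasure] {g : E → E} (hg : ContDiff ℝ 1 g) {R : ℝ}
    (hR : ∀ x ∉ closedBall (0 : E) R, g x = 0) {φ : E → ℝ} (hφ : Continuous φ) {d : ℕ}
    (hpoly : ∀ x y : E, ∃ p : Polynomial ℝ, p.natDegree ≤ d ∧ ∀ t, p.eval t = φ (x + t • y)) :
    ∫ x in closedBall 0 R, φ (x + g x) * (ContinuousLinearMap.id ℝ E + fderiv ℝ g x).det ∂ν =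
      ∫ x in closedBall 0 R, φ x ∂ν := by
  have hsupp : HasCompactSupport g := HasCompactSupport.intro (isCompact_closedBall 0 R) hR
  obtain ⟨K, hK⟩ := hg.lipschitzWith_of_hasCompactSupport hsupp one_ne_zero
  have hsmall : ∀ t : ℝ, 0 < t → t < 1 / (K + 1) →
      ∫ x in closedBall 0 R,
        φ (x + t • g x) * (ContinuousLinearMap.id ℝ E + t • fderiv ℝ g x).det ∂ν =
      ∫ x in closedBall 0 R, φ x ∂ν := by
    intro t ht htK
    have htK' : t * K < 1 := by
      rw [lt_div_iff₀ (by positivity)] at htK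
      nlinarith
    have hder : ∀ x ∈ closedBall (0 : E) R, HasFDerivWithinAt (fun x => x + t • g x)
        (ContinuousLinearMap.id ℝ E + t • fderiv ℝ g x) (closedBall 0 R) x := fun x _ =>
      ((hasFDerivAt_id x).add
        ((hg.differentiable one_ne_zero x).hasFDerivAt.const_smul t)).hasFDerivWithinAt
    have := integral_image_eq_integral_abs_det_fderiv_smul ν measurableSet_closedBall hder
      (id_add_smul_injective hK ht.le htK').injOn φ
    rw [id_add_smul_image_eq hK ht.le htK' hR] at this
    rw [this]
    congr 1 with x
    rw [abs_of_pos (det_id_add_smul_pos _ (norm_fderiv_le_of_lipschitz ℝ hK) ht.le htK'),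
      smul_eq_mul, mul_comm]
  obtain ⟨v, w, hv, hw, hvw⟩ := exists_extrapolation_weights (d + Module.finrank ℝ E)
    (ε := 1 / ((K : ℝ) + 1)) (by positivity)
  -- Extrapolating the integrand pointwise, with weights independent of `x`, reduces `t = 1` to
  -- small values of `t`.
  have hextra : ∀ x, φ (x + g x) * (ContinuousLinearMap.id ℝ E + fderiv ℝ g x).det =
      ∑ i, w i * (φ (x + v i • g x) *
        (ContinuousLinearMap.id ℝ E + v i • fderiv ℝ g x).det) := by
    intro x
    obtain ⟨p, hpd, hp⟩ := hpoly x (g x)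
    obtain ⟨r, hrd, hr⟩ := exists_polynomial_det_one_add_smul (fderiv ℝ g x)
    have := hvw (p * r) (Polynomial.natDegree_mul_le.trans (add_le_add hpd hrd))
    simpa [hp, hr] using this
  have hcont : ∀ t : ℝ, Continuous fun x =>
      φ (x + t • g x) * (ContinuousLinearMap.id ℝ E + t • fderiv ℝ g x).det := by
    intro t
    have h1 := hg.continuous
    have h2 := hg.continuous_fderiv one_ne_zero
    refine Continuous.mul (by fun_prop) (ContinuousLinearMap.continuous_det.comp ?_)
    fun_prop
  simp_rw [hextra]
  rw [integral_finsetSum _ fun i _ =>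
    ((hcont (v i)).continuousOn.integrableOn_compact (isCompact_closedBall 0 R)).const_mul _]
  simp_rw [integral_const_mul, fun i => hsmall (v i) (hv i).1 (hv i).2, ← Finset.sum_mul, hw,
    one_mul]

/-- A `C¹` map that is the identity outside of a compact set has a zero. -/
theorem exists_id_add_eq_zero {g : E → E} (hg : ContDiff ℝ 1 g) (hs : HasCompactSupport g) :
    ∃ x, x + g x = 0 := by
  by_contra! hne
  borelize E
  let ν : Measure E := Measure.addHaar
  obtain ⟨R, hRpos, hR⟩ := hs.isBounded.subset_closedBall_lt 0 0
  have hg0 : ∀ x ∉ closedBall (0 : E) R, g x = 0 := fun x hx =>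
    image_eq_zero_of_notMem_tsupport fun h => hx (hR h)
  have hB := isCompact_closedBall (0 : E) R
  have h0B : (0 : E) ∈ closedBall (0 : E) R := by simp [hRpos.le]
  have hgc := hg.continuous
  have hcont : Continuous fun x => x + g x := by fun_prop
  obtain ⟨x₀, -, hx₀⟩ := hB.exists_isMinOn ⟨0, h0B⟩ hcont.norm.continuousOn
  obtain ⟨M₀, hM₀⟩ := hB.exists_bound_of_continuousOn hcont.continuousOn
  have hdet : Continuous fun x => (ContinuousLinearMap.id ℝ E + fderiv ℝ g x).det := by
    have h2 := hg.continuous_fderiv one_ne_zero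
    exact ContinuousLinearMap.continuous_det.comp (by fun_prop)
  obtain ⟨D, hD⟩ := hB.exists_bound_of_continuousOn hdet.continuousOn
  set δ := ‖x₀ + g x₀‖ with hδ
  have hδpos : 0 < δ := norm_pos_iff.2 (hne x₀)
  have hδle : ∀ x ∈ closedBall (0 : E) R, δ ≤ ‖x + g x‖ := fun x hx => hx₀ hx
  -- `M` bounds both `‖x + g x‖` and `‖x‖` on the ball, so `1 - ‖·‖² / M²` is nonnegative at both
  -- points.
  set M := max M₀ R with hM
  have hMpos : 0 < M := hRpos.trans_le (le_max_right _ _)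
  have hMle : ∀ x ∈ closedBall (0 : E) R, ‖x + g x‖ ≤ M := fun x hx =>
    (hM₀ x hx).trans (le_max_left _ _)
  -- On the `ρ`-ball the test function has base at least `b`, while along `x + g x` its base is at
  -- most `a < b`.
  set ρ := min (δ / 2) R with hρ
  have hρpos : 0 < ρ := lt_min (by positivity) hRpos
  have hρδ : ρ < δ := (min_le_left _ _).trans_lt (by linarith)
  have hδM : δ ≤ M := (hδle 0 h0B).trans (hMle 0 h0B)
  set a := 1 - δ ^ 2 / M ^ 2 with ha
  set b := 1 - ρ ^ 2 / M ^ 2 with hb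
  have hab : a < b := by
    have : ρ ^ 2 / M ^ 2 < δ ^ 2 / M ^ 2 := by gcongr
    linarith
  have ha0 : 0 ≤ a := by
    have : δ ^ 2 / M ^ 2 ≤ 1 := by
      rw [div_le_one (by positivity)]
      gcongr
    linarith
  have hb0 : 0 < b := ha0.trans_lt hab
  set V := ν.real (closedBall (0 : E) R) with hV
  set v := ν.real (closedBall (0 : E) ρ) with hv
  have hvpos : 0 < v := ENNReal.toReal_pos
    (measure_closedBall_pos ν 0 hρpos).ne' (isCompact_closedBall _ _).measure_lt_top.ne
  have hφc : ∀ k : ℕ, Continuous fun y : E => (1 - ‖y‖ ^ 2 / M ^ 2) ^ k := by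
    intro k; fun_prop
  have key : ∀ k : ℕ, b ^ k * v ≤ a ^ k * D * V := by
    intro k
    have heq := setIntegral_comp_id_add_mul_det ν hg hg0 (hφc k) (d := k * 2) (by
      intro x y
      refine ⟨(Polynomial.C (1 - ‖x‖ ^ 2 / M ^ 2)
        + Polynomial.C (-(2 * inner ℝ x y / M ^ 2)) * Polynomial.X
        + Polynomial.C (-(‖y‖ ^ 2 / M ^ 2)) * Polynomial.X ^ 2) ^ k, ?_, ?_⟩
      · refine Polynomial.natDegree_pow_le_of_le k ?_
        compute_degree
      · intro t
        have : ‖x + t • y‖ ^ 2 = ‖x‖ ^ 2 + 2 * t * inner ℝ x y + t ^ 2 * ‖y‖ ^ 2 := by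
          rw [norm_add_sq_real, norm_smul, inner_smul_right, mul_pow, Real.norm_eq_abs, sq_abs]
          ring
        rw [this]
        simp only [Polynomial.eval_pow, Polynomial.eval_add, Polynomial.eval_mul,
          Polynomial.eval_C, Polynomial.eval_X]
        congr 1
        ring)
    have hupper : ∫ x in closedBall 0 R, (1 - ‖x + g x‖ ^ 2 / M ^ 2) ^ k *
        (ContinuousLinearMap.id ℝ E + fderiv ℝ g x).det ∂ν ≤ a ^ k * D * V := by
      refine (Real.le_norm_self _).trans
        (norm_setIntegral_le_of_norm_le_const hB.measure_lt_top fun x hx => ?_)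
      have h1 : 0 ≤ 1 - ‖x + g x‖ ^ 2 / M ^ 2 := by
        rw [sub_nonneg, div_le_one (by positivity)]
        gcongr
        exact hMle x hx
      rw [norm_mul, norm_pow, Real.norm_of_nonneg h1]
      gcongr
      · rw [ha]
        gcongr
        exact hδle x hx
      · exact hD x hx
    have hlower : b ^ k * v ≤ ∫ x in closedBall (0 : E) R, (1 - ‖x‖ ^ 2 / M ^ 2) ^ k ∂ν := by
      have hint : ∀ r, IntegrableOn (fun x : E => (1 - ‖x‖ ^ 2 / M ^ 2) ^ k)
          (closedBall (0 : E) r) ν := fun r =>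
        (hφc k).continuousOn.integrableOn_compact (isCompact_closedBall 0 r)
      calc b ^ k * v = ∫ x in closedBall (0 : E) ρ, b ^ k ∂ν := by
            rw [setIntegral_const, smul_eq_mul, mul_comm]
        _ ≤ ∫ x in closedBall (0 : E) ρ, (1 - ‖x‖ ^ 2 / M ^ 2) ^ k ∂ν := by
            refine setIntegral_mono_on (integrableOn_const
              (isCompact_closedBall (0 : E) ρ).measure_lt_top.ne) (hint ρ)
              measurableSet_closedBall fun x hx => ?_
            have : ‖x‖ ≤ ρ := by simpa using hx
            rw [hb]
            gcongr
        _ ≤ _ := by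
            refine setIntegral_mono_set (hint R) ?_
              (closedBall_subset_closedBall (min_le_right _ _)).eventuallyLE
            refine (ae_restrict_iff' measurableSet_closedBall).2 (.of_forall fun x hx => ?_)
            have : ‖x‖ ≤ M := (by simpa using hx : ‖x‖ ≤ R).trans (le_max_right _ _)
            refine pow_nonneg ?_ k
            rw [sub_nonneg, div_le_one (by positivity)]
            gcongr
    exact hlower.trans (heq ▸ hupper)
  have hlim : Filter.Tendsto (fun k : ℕ => (a / b) ^ k * (D * V)) Filter.atTop (nhds 0) := by
    simpa using (tendsto_pow_atTop_nhds_zero_of_lt_one (div_nonneg ha0 hb0.le)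
      ((div_lt_one hb0).2 hab)).mul_const (D * V)
  refine absurd (ge_of_tendsto' hlim fun k => ?_) (not_le.2 hvpos)
  rw [div_pow, div_mul_eq_mul_div, le_div_iff₀ (by positivity)]
  linarith [key k]

/-- **Brouwer's fixed point theorem** for bounded continuous self-maps of a Euclidean space. -/
theorem exists_fixedPoint_of_bounded {f : E → E} (hf : Continuous f) {R : ℝ}
    (hR : ∀ x, ‖f x‖ ≤ R) : ∃ x, f x = x := by
  have hR0 : 0 ≤ R := (norm_nonneg _).trans (hR 0)
  have happrox : ∀ ε : ℝ, 0 < ε → ε ≤ 1 → ∃ x ∈ closedBall (0 : E) (R + 1), ‖f x - x‖ ≤ ε := by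
    intro ε hε hε1
    obtain ⟨g, hg, hgf, -⟩ := hf.exists_contDiff_approx 1 (ε := fun _ => ε) continuous_const
      fun _ => hε
    -- The cutoff makes the perturbation compactly supported. Any solution of `x = χ x • g x` has
    -- norm at most `R + 1`, where `χ = 1`, so it is a fixed point of `g`.
    let χ : ContDiffBump (0 : E) := ⟨R + 1, R + 2, by positivity, by linarith⟩
    obtain ⟨x, hx⟩ := exists_id_add_eq_zero (g := fun x => -(χ x • g x))
      ((χ.contDiff.smul hg).neg) (χ.hasCompactSupport.smul_right.neg)
    have hx' : x = χ x • g x := by rwa [← sub_eq_add_neg, sub_eq_zero] at hx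
    have hgx : ‖g x‖ ≤ R + 1 := by
      have h1 := (hgf x).le
      rw [dist_eq_norm] at h1
      have := norm_le_norm_add_norm_sub' (g x) (f x)
      linarith [hR x]
    have hxB : x ∈ closedBall (0 : E) (R + 1) := by
      rw [mem_closedBall_zero_iff]
      calc ‖x‖ = χ x * ‖g x‖ := by
            conv_lhs => rw [hx', norm_smul, Real.norm_of_nonneg χ.nonneg]
        _ ≤ 1 * ‖g x‖ := by gcongr; exact χ.le_one
        _ ≤ R + 1 := by linarith
    refine ⟨x, hxB, ?_⟩
    rw [χ.one_of_mem_closedBall hxB, one_smul] at hx'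
    have h1 := (hgf x).le
    rwa [← hx', dist_comm, dist_eq_norm] at h1
  obtain ⟨x, -, hx⟩ := (isCompact_closedBall (0 : E) (R + 1)).exists_isMinOn
    ⟨0, by simpa using by linarith⟩ (f := fun x => ‖f x - x‖) (by fun_prop)
  refine ⟨x, sub_eq_zero.1 (norm_eq_zero.1 (le_antisymm ?_ (norm_nonneg _)))⟩
  refine le_of_forall_pos_le_add fun ε hε => ?_
  obtain ⟨y, hy, hyε⟩ := happrox (min ε 1) (by positivity) (min_le_right _ _)
  have : ‖f x - x‖ ≤ ‖f y - y‖ := hx hy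
  linarith [min_le_left ε 1]

/-! ### Transfer to the simplex -/

section Simplex

variable {ι : Type*} [Fintype ι]

/-- A continuous retraction of `ι → ℝ` onto the standard simplex. -/
noncomputable def simplexRetraction (x : ι → ℝ) (i : ι) : ℝ :=
  (max (x i) 0 + max (1 - ∑ j, max (x j) 0) 0 / Fintype.card ι) / max (∑ j, max (x j) 0) 1

theorem continuous_simplexRetraction : Continuous (simplexRetraction (ι := ι)) := by
  refine continuous_pi fun i => ?_
  unfold simplexRetraction
  refine Continuous.div (by fun_prop) (by fun_prop) fun x => ?_
  exact (zero_lt_one.trans_le (le_max_right _ _)).ne'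

theorem simplexRetraction_mem [Nonempty ι] (x : ι → ℝ) :
    simplexRetraction x ∈ stdSimplex ℝ ι := by
  refine ⟨fun i => by unfold simplexRetraction; positivity, ?_⟩
  unfold simplexRetraction
  have hι : (Fintype.card ι : ℝ) ≠ 0 := by simp
  rw [← Finset.sum_div, Finset.sum_add_distrib, Finset.sum_const, card_univ, nsmul_eq_mul,
    mul_div_cancel₀ _ hι]
  set S := ∑ j, max (x j) 0
  -- Missing mass is spread evenly; excess mass is normalised away.
  rcases le_total S 1 with h | h
  · rw [max_eq_right h, max_eq_left (by linarith)]; ring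
  · rw [max_eq_left h, max_eq_right (by linarith), add_zero, div_self (by positivity)]

theorem simplexRetraction_of_mem {x : ι → ℝ} (hx : x ∈ stdSimplex ℝ ι) :
    simplexRetraction x = x := by
  ext i
  have h : ∀ j, max (x j) 0 = x j := fun j => max_eq_left (hx.1 j)
  simp [simplexRetraction, h, hx.2]

/-- **Brouwer's fixed point theorem** for the standard simplex. -/
theorem exists_fixedPoint_stdSimplex [Nonempty ι] {f : (ι → ℝ) → ι → ℝ}
    (hf : ContinuousOn f (stdSimplex ℝ ι))
    (hmaps : Set.MapsTo f (stdSimplex ℝ ι) (stdSimplex ℝ ι)) :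
    ∃ x ∈ stdSimplex ℝ ι, f x = x := by
  have hc : Continuous fun x => f (simplexRetraction x) :=
    hf.comp_continuous continuous_simplexRetraction simplexRetraction_mem
  obtain ⟨R, hR⟩ := ((isCompact_stdSimplex ℝ ι).image
    (PiLp.continuous_toLp 2 fun _ : ι => ℝ)).isBounded.exists_norm_le
  obtain ⟨x, hx⟩ := exists_fixedPoint_of_bounded (E := EuclideanSpace ℝ ι)
    (f := fun x => WithLp.toLp 2 (f (simplexRetraction (WithLp.ofLp x))))
    ((PiLp.continuous_toLp 2 _).comp (hc.comp (PiLp.continuous_ofLp 2 _))) (R := R)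
    fun x => hR _ ⟨_, hmaps (simplexRetraction_mem _), rfl⟩
  have hx' : f (simplexRetraction (WithLp.ofLp x)) = WithLp.ofLp x := congrArg WithLp.ofLp hx
  have hmem : WithLp.ofLp x ∈ stdSimplex ℝ ι := hx' ▸ hmaps (simplexRetraction_mem _)
  exact ⟨WithLp.ofLp x, hmem, by rwa [simplexRetraction_of_mem hmem] at hx'⟩

end Simplex

end Brouwer

namespace NED

/-! ### Probabilistic rounding -/

/-- The probability that `x` is rounded to `m`, a hat function. -/
noncomputable def hat (m : ℕ) (x : ℝ) : ℝ := max (1 - |max x 0 - m|) 0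

theorem continuous_hat (m : ℕ) : Continuous (hat m) := by unfold hat; fun_prop

instance isProbabilityMeasure_roundLaw (x : ℝ) : IsProbabilityMeasure (roundLaw x) := by
  refine ⟨?_⟩
  simp only [roundLaw, Measure.coe_add, Measure.coe_smul, Pi.add_apply, Pi.smul_apply,
    measure_univ, smul_eq_mul, mul_one]
  rw [← ENNReal.ofReal_add (Int.fract_nonneg x) (by linarith [Int.fract_lt_one x])]
  simp

theorem integral_roundLaw (x : ℝ) (f : ℕ → ℝ) :
    ∫ m, f m ∂roundLaw x = Int.fract x * f ⌈x⌉₊ + (1 - Int.fract x) * f ⌊x⌋₊ := by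
  have h : ∀ a : ℕ, Integrable f (Measure.dirac a) := fun a => integrable_dirac (by simp)
  rw [roundLaw, integral_add_measure ((h _).smul_measure (by simp))
    ((h _).smul_measure (by simp)), integral_smul_measure, integral_smul_measure,
    integral_dirac, integral_dirac, ENNReal.toReal_ofReal (Int.fract_nonneg x),
    ENNReal.toReal_ofReal (by linarith [Int.fract_lt_one x]), smul_eq_mul, smul_eq_mul]

theorem integral_roundLaw_of_nonpos {x : ℝ} (hx : x ≤ 0) (f : ℕ → ℝ) :
    ∫ m, f m ∂roundLaw x = f 0 := by
  rw [integral_roundLaw, Nat.ceil_eq_zero.2 hx, Nat.floor_of_nonpos hx]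
  ring

/-- The bound `N` makes the index set independent of `x`, so the sum is visibly continuous. -/
theorem integral_roundLaw_eq_sum_hat {x : ℝ} {N : ℕ} (hx : x < N) (f : ℕ → ℝ) :
    ∫ m, f m ∂roundLaw x = ∑ m ∈ range (N + 1), hat m x * f m := by
  rcases le_or_gt x 0 with h0 | h0
  · rw [integral_roundLaw_of_nonpos h0, Finset.sum_eq_single 0]
    · simp [hat, h0]
    · intro m _ hm
      have : (1 : ℝ) ≤ m := by exact_mod_cast Nat.one_le_iff_ne_zero.2 hm
      simp [hat, h0, this]
    · simp
  · have hfl := Nat.floor_le h0.le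
    have hlt := Nat.lt_floor_add_one x
    have hfr : Int.fract x = x - ⌊x⌋₊ := by
      rw [Int.fract, ← natCast_floor_eq_intCast_floor h0.le]
    have hfN : ⌊x⌋₊ < N := (Nat.floor_lt h0.le).2 hx
    have hsum : ∑ m ∈ range (N + 1), hat m x * f m =
        hat ⌊x⌋₊ x * f ⌊x⌋₊ + hat (⌊x⌋₊ + 1) x * f (⌊x⌋₊ + 1) := by
      refine Finset.sum_eq_add_of_mem _ _ (by simp; omega) (by simp; omega) (by omega) ?_
      rintro m - ⟨h1, h2⟩
      have : hat m x = 0 := by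
        unfold hat
        rw [max_eq_left h0.le, max_eq_right_iff]
        rcases lt_or_gt_of_ne h1 with h | h
        · have : (m : ℝ) + 1 ≤ ⌊x⌋₊ := by exact_mod_cast h
          linarith [le_abs_self (x - m)]
        · have : ((⌊x⌋₊ : ℕ) : ℝ) + 2 ≤ m := by
            exact_mod_cast (by omega : ⌊x⌋₊ + 2 ≤ m)
          linarith [neg_le_abs (x - m)]
      rw [this, zero_mul]
    have hh1 : hat ⌊x⌋₊ x = 1 - Int.fract x := by
      unfold hat
      rw [max_eq_left h0.le, abs_of_nonneg (by linarith), max_eq_left (by linarith), hfr]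
    have hh2 : hat (⌊x⌋₊ + 1) x = Int.fract x := by
      unfold hat
      push_cast
      rw [max_eq_left h0.le, abs_of_nonpos (by linarith), max_eq_left (by linarith), hfr]
      ring
    rw [integral_roundLaw, hsum, hh1, hh2]
    -- At an integer the ceiling is not `⌊x⌋₊ + 1`, but its weight is then zero.
    rcases eq_or_lt_of_le hfl with h | h
    · have : Int.fract x = 0 := by rw [hfr, h, sub_self]
      simp [this]
    · have : ⌈x⌉₊ = ⌊x⌋₊ + 1 := (Nat.ceil_eq_iff (by omega)).2 ⟨by simpa using h, by
        push_cast; exact hlt.le⟩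
      rw [this]
      ring

theorem integrable_roundLaw_prod (x y : ℝ) (f : ℕ × ℕ → ℝ) :
    Integrable f ((roundLaw x).prod (roundLaw y)) := by
  have h : ∀ a b : ℕ, Integrable f ((Measure.dirac a).prod (Measure.dirac b)) := fun a b => by
    rw [Measure.dirac_prod_dirac]
    exact integrable_dirac (by simp)
  simp only [roundLaw, Measure.prod_add, Measure.add_prod, Measure.prod_smul_left,
    Measure.prod_smul_right]
  refine Integrable.add_measure (Integrable.smul_measure ?_ ENNReal.ofReal_ne_top)
    (Integrable.smul_measure ?_ ENNReal.ofReal_ne_top) <;>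
    exact ((h _ _).smul_measure ENNReal.ofReal_ne_top).add_measure
      ((h _ _).smul_measure ENNReal.ofReal_ne_top)

theorem integral_roundLaw_prod (x y : ℝ) (f : ℕ → ℕ → ℝ) :
    ∫ s : ℕ × ℕ, f s.1 s.2 ∂((roundLaw x).prod (roundLaw y)) =
      ∫ m, ∫ n, f m n ∂roundLaw y ∂roundLaw x :=
  integral_prod _ (integrable_roundLaw_prod x y _)

theorem continuous_integral_roundLaw_prod (f : ℕ → ℕ → ℝ) :
    Continuous fun z : ℝ × ℝ =>
      ∫ s : ℕ × ℕ, f s.1 s.2 ∂((roundLaw z.1).prod (roundLaw z.2)) := by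
  refine continuous_iff_continuousAt.2 fun z => ?_
  obtain ⟨N, hN⟩ := exists_nat_gt (max z.1 z.2)
  have hc : Continuous fun z : ℝ × ℝ => ∑ m ∈ range (N + 1), hat m z.1 *
      ∑ n ∈ range (N + 1), hat n z.2 * f m n := by
    have := continuous_hat
    fun_prop
  refine hc.continuousAt.congr ?_
  have h1 : ∀ᶠ w : ℝ × ℝ in nhds z, w.1 < N :=
    continuous_fst.continuousAt.eventually_lt_const ((le_max_left _ _).trans_lt hN)
  have h2 : ∀ᶠ w : ℝ × ℝ in nhds z, w.2 < N :=
    continuous_snd.continuousAt.eventually_lt_const ((le_max_right _ _).trans_lt hN)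
  filter_upwards [h1, h2] with w hw1 hw2
  rw [integral_roundLaw_prod]
  simp_rw [integral_roundLaw_eq_sum_hat hw2]
  rw [integral_roundLaw_eq_sum_hat hw1]

/-! ### The simulator -/

variable {U : ℕ}

instance (m n : ℕ) : Finite (Packing U m n) := inferInstanceAs (Finite (Subtype _))

theorem measurable_score (m n : ℕ) : Measurable (score (m := m) (n := n)) := by
  refine measurable_pi_lambda _ fun r => measurable_pi_lambda _ fun d => ?_
  unfold score
  fun_prop

instance (m n : ℕ) : IsProbabilityMeasure (snapshotLaw m n) := by
  unfold snapshotLaw; infer_instance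

instance (alg : DispatchAlgorithm U) (m n : ℕ) : IsProbabilityMeasure (outcomeLaw alg m n) := by
  have := alg.isMarkov m n
  have := Measure.isProbabilityMeasure_map (μ := snapshotLaw m n)
    (measurable_score m n).aemeasurable
  unfold outcomeLaw
  infer_instance

theorem Packing.sum_count {m n : ℕ} (S : Packing U m n) : ∑ i, S.count i = m := by
  have := Finset.card_eq_sum_card_fiberwise (s := (univ : Finset (Fin m))) (t := univ)
    (f := fun r => (⟨#(S.1 r), Nat.lt_succ_of_le (S.2.2 r)⟩ : Fin (U + 1))) (by simp)
  simpa [Packing.count, Fin.ext_iff] using this.symm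

theorem empiricalFreq_mem {m n K : ℕ} (hK : 0 < K) {qe : Profile U}
    (hqe : qe ∈ stdSimplex ℝ (Fin (U + 1))) (ω : Fin K → Packing U m n) :
    empiricalFreq qe ω ∈ stdSimplex ℝ (Fin (U + 1)) := by
  by_cases hm : m = 0
  · have : empiricalFreq qe ω = qe := by ext i; simp [empiricalFreq, hm]
    rwa [this]
  · have hm' : (0 : ℝ) < m := by exact_mod_cast Nat.pos_of_ne_zero hm
    have hK' : (0 : ℝ) < K := by exact_mod_cast hK
    refine ⟨fun i => by simp only [empiricalFreq, hm, if_false]; positivity, ?_⟩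
    simp only [empiricalFreq, hm, if_false]
    rw [← Finset.sum_div, Finset.sum_comm, div_eq_one_iff_eq (by positivity)]
    have : ∀ k, ∑ i, ((ω k).count i : ℝ) = m := fun k => by
      exact_mod_cast (ω k).sum_count
    simp [this]

/-- The expectation of a random point of the simplex lies in the simplex. -/
theorem integral_mem_stdSimplex {ι Ω : Type*} [Fintype ι] [MeasurableSpace Ω] (ν : Measure Ω)
    [IsProbabilityMeasure ν] {X : Ω → ι → ℝ} (hX : ∀ ω, X ω ∈ stdSimplex ℝ ι)
    (hint : ∀ i, Integrable (fun ω => X ω i) ν) :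
    (fun i => ∫ ω, X ω i ∂ν) ∈ stdSimplex ℝ ι := by
  refine ⟨fun i => integral_nonneg fun ω => (hX ω).1 i, ?_⟩
  rw [← integral_finsetSum _ fun i _ => hint i]
  simp [(hX _).2]

theorem expectedFreq_mem (alg : DispatchAlgorithm U) {K : ℕ} (hK : 0 < K) {qe : Profile U}
    (hqe : qe ∈ stdSimplex ℝ (Fin (U + 1))) (m n : ℕ) :
    expectedFreq alg K qe m n ∈ stdSimplex ℝ (Fin (U + 1)) := by
  have : DiscreteMeasurableSpace (Packing U m n) := ⟨fun _ => trivial⟩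
  exact integral_mem_stdSimplex _ (fun ω => empiricalFreq_mem hK hqe ω) fun i => .of_finite

theorem simulate_mem (alg : DispatchAlgorithm U) {K : ℕ} (hK : 0 < K) {qe : Profile U}
    (hqe : qe ∈ stdSimplex ℝ (Fin (U + 1))) (x y : ℝ) :
    simulate alg K qe x y ∈ stdSimplex ℝ (Fin (U + 1)) :=
  integral_mem_stdSimplex _ (fun s : ℕ × ℕ => expectedFreq_mem alg hK hqe s.1 s.2) fun _ =>
    integrable_roundLaw_prod x y _

theorem continuousOn_simulate {X : Type*} [TopologicalSpace X] {s : Set X} {x y : X → ℝ}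
    (hx : ContinuousOn x s) (hy : ContinuousOn y s) (alg : DispatchAlgorithm U) (K : ℕ)
    (qe : Profile U) : ContinuousOn (fun a => simulate alg K qe (x a) (y a)) s := by
  refine continuousOn_pi.2 fun i => ?_
  have h := (continuous_integral_roundLaw_prod
    fun m n => expectedFreq alg K qe m n i).comp_continuousOn (hx.prodMk hy)
  simpa only [Function.comp_def, simulate] using h

/-- Without drivers no rider is notified to any driver. -/
theorem expectedFreq_zero_drivers (alg : DispatchAlgorithm U) {K : ℕ} (hK : 0 < K)
    (qe : Profile U) {m : ℕ} (hm : m ≠ 0 ∨ qe = Profile.idle U) :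
    expectedFreq alg K qe m 0 = Profile.idle U := by
  have h : ∀ ω : Fin K → Packing U m 0, empiricalFreq qe ω = Profile.idle U := by
    intro ω
    ext i
    by_cases hm0 : m = 0
    · simp [empiricalFreq, hm0, hm.resolve_left (not_not.2 hm0)]
    · have hm' : (m : ℝ) ≠ 0 := by exact_mod_cast hm0
      have hK' : (K : ℝ) ≠ 0 := by exact_mod_cast hK.ne'
      have hc : ∀ k, ((ω k).count i : ℝ) = m * Profile.idle U i := by
        intro k
        have h0 : ∀ r, #((ω k).1 r) = 0 := fun r => by simp [Finset.eq_empty_of_isEmpty]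
        by_cases hi : i = 0
        · simp [Packing.count, Profile.idle, h0, hi]
        · have : (0 : ℕ) ≠ (i : ℕ) := fun h => hi (Fin.ext h.symm)
          simp [Packing.count, Profile.idle, h0, hi, this]
      simp only [empiricalFreq, hm0, if_false, hc, sum_const, card_univ, Fintype.card_fin,
        nsmul_eq_mul]
      field_simp
  ext i
  simp [expectedFreq, h]

/-- If `x ≥ 1`, both roundings of `x` are nonzero, so the default profile `qe` is never reported. -/
theorem simulate_of_nonpos_drivers (alg : DispatchAlgorithm U) {K : ℕ} (hK : 0 < K)
    {qe : Profile U} {x y : ℝ} (hx : 1 ≤ x ∨ qe = Profile.idle U) (hy : y ≤ 0) :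
    simulate alg K qe x y = Profile.idle U := by
  ext i
  unfold simulate
  rw [integral_roundLaw_prod x y fun m n => expectedFreq alg K qe m n i]
  simp_rw [integral_roundLaw_of_nonpos hy]
  have hne : ∀ m : ℕ, m ≠ 0 ∨ qe = Profile.idle U →
      expectedFreq alg K qe m 0 i = Profile.idle U i := fun m hm => by
    rw [expectedFreq_zero_drivers alg hK qe hm]
  rw [integral_roundLaw, hne _ (hx.imp_left fun h => ?_), hne _ (hx.imp_left fun h => ?_)]
  · ring
  · exact (Nat.floor_pos.2 h).ne'
  · exact (Nat.ceil_pos.2 (by linarith)).ne'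

/-! ### The fluid stage -/

theorem continuous_entry (i : ℕ) : Continuous fun q : Profile U => q.entry i := by
  unfold Profile.entry
  split_ifs <;> fun_prop

theorem entry_nonneg {q : Profile U} (hq : q ∈ stdSimplex ℝ (Fin (U + 1))) (i : ℕ) :
    0 ≤ q.entry i := by
  unfold Profile.entry
  split_ifs
  exacts [hq.1 _, le_rfl]

theorem entry_idle {i : ℕ} (hi : 1 ≤ i) : (Profile.idle U).entry i = 0 := by
  unfold Profile.entry Profile.idle
  split_ifs with h
  · exact Pi.single_eq_of_ne (fun h0 => by simp [Fin.ext_iff] at h0; omega) _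
  · rfl

namespace Params

variable {P : Params}

/-- Each factor is at most one since `c ≤ mu + etaN`; this keeps `exitRate` at least `eta`. -/
theorem ratioProd_le_one (hP : P.Admissible) (a b : ℕ) : P.ratioProd a b ≤ 1 := by
  have hc : 0 ≤ P.c := hP.reject_pos.le
  have hη := hP.eta_pos
  have hμ := hP.mu_pos
  have hN := hP.etaN_nonneg
  refine Finset.prod_le_one (fun j _ => by positivity) fun j _ => ?_
  rw [div_le_one (by positivity)]
  have : P.c ≤ P.mu + P.etaN := by
    unfold Params.c
    nlinarith [hP.p_nonneg]
  nlinarith [mul_le_mul_of_nonneg_left this (Nat.cast_nonneg (α := ℝ) j)]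

theorem exitRate_pos (hP : P.Admissible) {q : Profile U}
    (hq : q ∈ stdSimplex ℝ (Fin (U + 1))) : 0 < P.exitRate q :=
  add_pos_of_pos_of_nonneg hP.eta_pos <| Finset.sum_nonneg fun i _ =>
    mul_nonneg (entry_nonneg hq i) (sub_nonneg.2 (ratioProd_le_one hP 1 i))

theorem R0_pos (hP : P.Admissible) {q : Profile U} (hq : q ∈ stdSimplex ℝ (Fin (U + 1))) :
    0 < P.R0 q :=
  div_pos hP.lam_pos (exitRate_pos hP hq)

theorem continuous_exitRate : Continuous fun q : Profile U => P.exitRate q := by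
  have := continuous_entry (U := U)
  unfold exitRate
  fun_prop

theorem continuousOn_R0 (hP : P.Admissible) :
    ContinuousOn (fun q : Profile U => P.R0 q) (stdSimplex ℝ (Fin (U + 1))) :=
  continuousOn_const.div continuous_exitRate.continuousOn fun _ hq => (exitRate_pos hP hq).ne'

theorem continuousOn_D0 (hP : P.Admissible) (prot : Protocol) :
    ContinuousOn (fun q : Profile U => P.D0 q prot) (stdSimplex ℝ (Fin (U + 1))) := by
  have he := continuous_entry (U := U)
  have hR := continuousOn_R0 (U := U) hP
  cases prot with
  | firstAccept =>
    have h : ContinuousOn (fun q : Profile U =>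
        (P.lam / P.c * ∑ l ∈ Icc 1 U, ∑ i ∈ Icc l U, q.entry i * P.ratioProd l i)
          / P.exitRate q) (stdSimplex ℝ (Fin (U + 1))) :=
      ContinuousOn.div (Continuous.continuousOn (by fun_prop))
        continuous_exitRate.continuousOn fun _ hq => (exitRate_pos hP hq).ne'
    simp only [D0, D0FA]
    fun_prop
  | bestAccept =>
    have hD : ∀ l, ContinuousOn (fun q : Profile U => P.DBA q l)
        (stdSimplex ℝ (Fin (U + 1))) := fun l =>
      hR.mul (continuous_finsetSum _ fun j _ =>
        ((continuous_finsetSum _ fun i _ => he i).const_mul _).div_const _).continuousOn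
    have hA : ∀ l, ContinuousOn (fun q : Profile U => P.ABA q l)
        (stdSimplex ℝ (Fin (U + 1))) := fun l =>
      hR.mul (((continuous_finsetSum _ fun i _ => (he i).mul_const _).div_const _).sub
        (continuous_finsetSum _ fun j _ =>
          ((continuous_finsetSum _ fun i _ => he i).const_mul _).div_const _)).continuousOn
    exact ((((continuousOn_const.add
      (continuousOn_finsetSum _ fun l _ => (hD l).mul_const _)).add
      (continuousOn_finsetSum _ fun l _ => (hA l).mul_const _)).sub
      (hR.mul (continuous_finsetSum _ fun l _ => (he l).const_mul _).continuousOn))).div_const _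

theorem D0_idle_pos (hP : P.Admissible) (prot : Protocol) : 0 < P.D0 (Profile.idle U) prot := by
  have hsum : ∀ (a : ℕ), 1 ≤ a → ∀ f : ℕ → ℝ,
      ∑ i ∈ Icc a U, (Profile.idle U).entry i * f i = 0 := fun a ha f =>
    Finset.sum_eq_zero fun i hi => by
      rw [entry_idle (ha.trans (Finset.mem_Icc.1 hi).1), zero_mul]
  have hsum' : ∀ (a : ℕ), 1 ≤ a → ∑ i ∈ Icc a U, (Profile.idle U).entry i = 0 := fun a ha => by
    simpa using hsum a ha fun _ => 1
  have hpos := div_pos hP.lamD_pos hP.etaI_pos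
  cases prot with
  | firstAccept =>
    have h : ∑ l ∈ Icc 1 U, ∑ i ∈ Icc l U, (Profile.idle U).entry i * P.ratioProd l i = 0 :=
      Finset.sum_eq_zero fun l hl => hsum l (Finset.mem_Icc.1 hl).1 _
    simpa [D0, D0FA, h] using hpos
  | bestAccept =>
    have hD : ∀ l ∈ Icc 1 U, P.DBA (Profile.idle U) l = 0 := by
      intro l hl
      unfold DBA
      rw [Finset.sum_eq_zero fun j hj => ?_, mul_zero]
      rw [hsum' j ((Finset.mem_Icc.1 hl).1.trans (Finset.mem_Icc.1 hj).1), mul_zero, zero_div]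
    have hA : ∀ l ∈ Icc 2 U, P.ABA (Profile.idle U) l = 0 := by
      intro l hl
      have hl2 := (Finset.mem_Icc.1 hl).1
      unfold ABA
      -- The inner sum starts at `l - 1`; as `l ≥ 2`, it still avoids the entry `q_0 = 1`.
      rw [hsum (l - 1) (by omega), Finset.sum_eq_zero fun j hj => ?_]
      · simp
      · rw [hsum' j (by have := (Finset.mem_Icc.1 hj).1; omega), mul_zero, zero_div]
    have h1 : ∑ l ∈ Icc 1 U, P.DBA (Profile.idle U) l *
        (P.eta + P.mu * (1 - P.p) + ((l : ℝ) - 1) * P.mu * P.p) = 0 :=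
      Finset.sum_eq_zero fun l hl => by rw [hD l hl, zero_mul]
    have h2 : ∑ l ∈ Icc 2 U, P.ABA (Profile.idle U) l *
        (P.eta + ((l : ℝ) - 1) * P.mu * P.p) = 0 :=
      Finset.sum_eq_zero fun l hl => by rw [hA l hl, zero_mul]
    have h3 : ∑ l ∈ Icc 1 U, (l : ℝ) * (Profile.idle U).entry l = 0 := by
      simpa [mul_comm] using hsum 1 le_rfl fun l => (l : ℝ)
    simpa [D0, D0BA, h1, h2, h3] using hpos

end Params

end NED

/-! ### Existence and positivity of the fixed point -/

theorem theorem1 (U : ℕ) (P : NED.Params) (hP : P.Admissible) (prot : NED.Protocol)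
    (alg : NED.DispatchAlgorithm U) (K : ℕ) (hK : 0 < K)
    (qe : NED.Profile U) (hqe : qe ∈ stdSimplex ℝ (Fin (U + 1))) :
    Set.MapsTo (NED.iterMap P prot alg K qe)
        (stdSimplex ℝ (Fin (U + 1))) (stdSimplex ℝ (Fin (U + 1))) ∧
      ∃ q ∈ stdSimplex ℝ (Fin (U + 1)),
        NED.iterMap P prot alg K qe q = q ∧
        0 < P.R0 q ∧
        (1 ≤ P.R0 q ∨ qe = NED.Profile.idle U → 0 < P.D0 q prot) := by
  have hmaps : Set.MapsTo (NED.iterMap P prot alg K qe)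
      (stdSimplex ℝ (Fin (U + 1))) (stdSimplex ℝ (Fin (U + 1))) := fun q _ =>
    NED.simulate_mem alg hK hqe (P.R0 q) (P.D0 q prot)
  have hcont : ContinuousOn (NED.iterMap P prot alg K qe) (stdSimplex ℝ (Fin (U + 1))) :=
    NED.continuousOn_simulate (NED.Params.continuousOn_R0 hP)
      (NED.Params.continuousOn_D0 hP prot) alg K qe
  obtain ⟨q, hq, hfix⟩ := Brouwer.exists_fixedPoint_stdSimplex hcont hmaps
  refine ⟨hmaps, q, hq, hfix, NED.Params.R0_pos hP hq, fun h => ?_⟩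
  by_contra! hD
  have hidle : q = NED.Profile.idle U :=
    hfix.symm.trans (NED.simulate_of_nonpos_drivers alg hK h hD)
  rw [hidle] at hD
  exact hD.not_gt (NED.Params.D0_idle_pos hP prot)
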